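/- For a polynomial $p\in\mathbb{R}[x]$ let $\mathscr{W}(p)\in\mathbb{R}[x]$ denote the polynomial (of degree at most $\deg p$) determined by the identity of formal power series $$\sum_{j\ge 0} p(j)\,x^j=\frac{\mathscr{W}(p)(x)}{(1-x)^{\deg p+1}}$$ (with $\mathscr{W}(0)=0$). A polynomial $a(x)=\sum_j a_jx^j$ is said to have no internal zeros if there are no indices $0\le i<j<k$ with $a_j=0$ and $a_ia_k\neq 0$. **Proposition.** Let $p,q\in\mathbb{R}[x]$ be polynomials such that both $\mathscr{W}(p)$ and $\mathscr{W}(q)$ have only nonnegative coefficients and no internal zeros. Then $\mathscr{W}(pq)$ also has no internal zeros. -/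

import Mathlib

open scoped PowerSeries

/-- The generating function `∑_{j ≥ 0} p(j) x^j` of the values of `p` at `0, 1, 2, …`. -/
noncomputable def genSeries (p : Polynomial ℝ) : ℝ⟦X⟧ :=
  PowerSeries.mk fun j : ℕ => p.eval (j : ℝ)

/-- The numerator polynomial of `∑_{j ≥ 0} p(j) x^j` over the denominator
`(1 - x)^(deg p + 1)`: the coefficients of `(∑_{j ≥ 0} p(j) x^j) * (1 - x)^(deg p + 1)`
in degrees `0, …, deg p`.  All further coefficients of that power series vanish, see
`coe_numeratorW`. -/
noncomputable def numeratorW (p : Polynomial ℝ) : Polynomial ℝ :=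
  PowerSeries.trunc (p.natDegree + 1)
    (genSeries p * (1 - PowerSeries.X) ^ (p.natDegree + 1))

lemma coeff_mk_mul_one_sub_X_pow (f : ℕ → ℝ) (n m : ℕ) :
    PowerSeries.coeff (m + n) (PowerSeries.mk f * (1 - PowerSeries.X) ^ n)
      = (fwdDiff 1)^[n] f m := by
  induction n generalizing m with
  | zero => simp
  | succ n ih =>
    rw [pow_succ, ← mul_assoc, mul_sub, mul_one, ← add_assoc, map_sub,
      PowerSeries.coeff_succ_mul_X, ih m, Function.iterate_succ_apply', fwdDiff]
    rw [show m + n + 1 = (m + 1) + n by ring, ih (m + 1)]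

/-- The defining identity `∑_{j ≥ 0} p(j) x^j = numeratorW p / (1 - x)^(deg p + 1)`. -/
theorem coe_numeratorW (p : Polynomial ℝ) :
    (numeratorW p : ℝ⟦X⟧) = genSeries p * (1 - PowerSeries.X) ^ (p.natDegree + 1) := by
  ext k
  rw [Polynomial.coeff_coe, numeratorW, PowerSeries.coeff_trunc]
  split_ifs with h
  · rfl
  · obtain ⟨m, rfl⟩ := Nat.exists_eq_add_of_le' (not_lt.mp h)
    have h1 := congrFun (Polynomial.fwdDiff_iter_degree_add_one_eq_zero p) (m : ℝ)
    rw [genSeries, coeff_mk_mul_one_sub_X_pow, fwdDiff_iter_eq_sum_shift]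
    rw [fwdDiff_iter_eq_sum_shift] at h1
    simpa using h1.symm

/-- No zero coefficient lies strictly between two nonzero coefficients. -/
def NoInternalZeros (a : Polynomial ℝ) : Prop :=
  ¬ ∃ i j k : ℕ, i < j ∧ j < k ∧ a.coeff j = 0 ∧ a.coeff i * a.coeff k ≠ 0

/-- The binomial coefficient with an integer lower index, zero when that index is negative. -/
noncomputable def chooseInt (n : ℕ) (z : ℤ) : ℝ :=
  if 0 ≤ z then (n.choose z.toNat : ℝ) else 0

lemma chooseInt_natCast (n k : ℕ) : chooseInt n k = n.choose k := by
  simp [chooseInt]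

lemma chooseInt_of_neg (n : ℕ) {z : ℤ} (h : z < 0) : chooseInt n z = 0 := by
  simp [chooseInt, not_le.mpr h]

lemma chooseInt_nonneg (n : ℕ) (z : ℤ) : 0 ≤ chooseInt n z := by
  unfold chooseInt
  split_ifs <;> positivity

lemma chooseInt_ne_zero_iff (n : ℕ) (z : ℤ) : chooseInt n z ≠ 0 ↔ 0 ≤ z ∧ z ≤ n := by
  unfold chooseInt
  split_ifs with h
  · rw [Nat.cast_ne_zero, Nat.choose_ne_zero_iff]
    omega
  · simp [h]

lemma chooseInt_succ (n : ℕ) (z : ℤ) :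
    chooseInt (n + 1) z = chooseInt n z + chooseInt n (z - 1) := by
  rcases lt_or_ge z 0 with h | h
  · simp [chooseInt_of_neg _ h, chooseInt_of_neg _ (show z - 1 < 0 by omega)]
  · lift z to ℕ using h
    cases z with
    | zero =>
      rw [chooseInt_natCast, chooseInt_natCast, chooseInt_of_neg _ (by simp)]
      simp
    | succ k =>
      rw [show ((k + 1 : ℕ) : ℤ) - 1 = (k : ℕ) by push_cast; ring]
      simp only [chooseInt_natCast]
      rw [Nat.choose_succ_succ]
      push_cast
      ring

lemma mul_chooseInt (n : ℕ) (z : ℤ) :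
    (z : ℝ) * chooseInt n z = (n - z + 1) * chooseInt n (z - 1) := by
  rcases lt_or_ge z 0 with h | h
  · simp [chooseInt_of_neg _ h, chooseInt_of_neg _ (show z - 1 < 0 by omega)]
  · lift z to ℕ using h
    cases z with
    | zero =>
      rw [chooseInt_of_neg _ (show ((0 : ℕ) : ℤ) - 1 < 0 by simp)]
      simp
    | succ k =>
      rw [show ((k + 1 : ℕ) : ℤ) - 1 = (k : ℕ) by push_cast; ring]
      simp only [chooseInt_natCast]
      rcases le_or_gt k n with hk | hk
      · have h1 := Nat.choose_succ_right_eq n k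
        have h2 : ((n.choose (k + 1) : ℝ)) * (k + 1) = n.choose k * (n - k) := by
          rw [← Nat.cast_sub hk]
          exact_mod_cast h1
        push_cast
        linear_combination h2
      · simp [Nat.choose_eq_zero_of_lt hk, Nat.choose_eq_zero_of_lt (hk.trans k.lt_succ_self)]

/-- The coefficient of `X ^ x` in `X ^ k / (1 - X) ^ (d + 1)`. -/
noncomputable def shiftedChoose (d k x : ℕ) : ℝ :=
  if k ≤ x then ((x - k + d).choose d : ℝ) else 0

lemma shiftedChoose_of_lt (d : ℕ) {k x : ℕ} (h : x < k) : shiftedChoose d k x = 0 := by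
  simp [shiftedChoose, not_le.mpr h]

lemma shiftedChoose_add (d k t : ℕ) : shiftedChoose d k (k + t) = (t + d).choose d := by
  simp [shiftedChoose]

lemma add_mul_shiftedChoose (d k x : ℕ) (c : ℝ) :
    (x + c) * shiftedChoose d k x =
      (k + c) * shiftedChoose (d + 1) k x +
        (d + 1 - k - c) * shiftedChoose (d + 1) (k + 1) x := by
  rcases lt_or_ge x k with h | h
  · simp [shiftedChoose_of_lt _ h, shiftedChoose_of_lt _ (h.trans k.lt_succ_self)]
  · obtain ⟨t, rfl⟩ := Nat.exists_eq_add_of_le h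
    cases t with
    | zero =>
      rw [shiftedChoose_add, shiftedChoose_add, shiftedChoose_of_lt _ (by omega)]
      simp
    | succ t =>
      rw [shiftedChoose_add, shiftedChoose_add, show k + (t + 1) = k + 1 + t by ring,
        shiftedChoose_add]
      rw [show t + 1 + (d + 1) = (t + (d + 1)) + 1 by ring, Nat.choose_succ_succ,
        show t + 1 + d = t + (d + 1) by ring]
      have h1 := Nat.choose_succ_right_eq (t + (d + 1)) d
      rw [show t + (d + 1) - d = t + 1 by omega] at h1
      have h2 : (((t + (d + 1)).choose (d + 1) : ℝ)) * (d + 1)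
          = (t + (d + 1)).choose d * (t + 1) := by exact_mod_cast h1
      push_cast
      linear_combination -h2

/-- The coefficient of `shiftedChoose (u + i + (v + j)) k` in the product of
`shiftedChoose (u + i) i` and `shiftedChoose (v + j) j`. -/
noncomputable def productCoeff (u i v j : ℕ) (z : ℤ) : ℝ :=
  chooseInt (u + j) (z - i) * chooseInt (v + i) (z - j)

lemma productCoeff_nonneg (u i v j : ℕ) (z : ℤ) : 0 ≤ productCoeff u i v j z :=
  mul_nonneg (chooseInt_nonneg _ _) (chooseInt_nonneg _ _)

lemma productCoeff_ne_zero_iff (u i v j k : ℕ) :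
    productCoeff u i v j k ≠ 0 ↔ i ≤ k ∧ j ≤ k ∧ k ≤ u + i + j ∧ k ≤ v + j + i := by
  rw [productCoeff, mul_ne_zero_iff, chooseInt_ne_zero_iff, chooseInt_ne_zero_iff]
  push_cast
  omega

lemma productCoeff_of_neg (u i v j : ℕ) {z : ℤ} (h : z < 0) : productCoeff u i v j z = 0 := by
  rw [productCoeff, chooseInt_of_neg _ (by omega), zero_mul]

lemma productCoeff_zero_zero (u i k : ℕ) :
    productCoeff u i 0 0 k = if k = i then 1 else 0 := by
  split_ifs with h
  · subst h
    simp [productCoeff, chooseInt]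
  · by_contra h'
    have := (productCoeff_ne_zero_iff u i 0 0 k).1 h'
    omega

lemma productCoeff_succ_right (u i v j : ℕ) (z : ℤ) :
    ((v + j : ℝ) + 1) * productCoeff u i v (j + 1) z =
      (z - j) * productCoeff u i v j z +
        ((u + i : ℝ) + (v + j) + 2 - z + j) * productCoeff u i v j (z - 1) := by
  unfold productCoeff
  rw [← add_assoc, chooseInt_succ, show z - ((j + 1 : ℕ) : ℤ) = z - j - 1 by push_cast; ring,
    show z - 1 - (i : ℤ) = z - i - 1 by ring, show z - 1 - (j : ℤ) = z - j - 1 by ring]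
  have h1 := mul_chooseInt (u + j) (z - i)
  have h2 := mul_chooseInt (v + i) (z - j)
  push_cast at h1 h2
  linear_combination chooseInt (v + i) (z - j - 1) * h1 - chooseInt (u + j) (z - i) * h2

lemma productCoeff_succ_left (u i v j : ℕ) (z : ℤ) :
    ((v + j : ℝ) + 1) * productCoeff u i (v + 1) j z =
      (z + (v + 1)) * productCoeff u i v j z +
        ((u + i : ℝ) + j + 1 - z) * productCoeff u i v j (z - 1) := by
  unfold productCoeff
  rw [add_right_comm v 1 i, chooseInt_succ, show z - 1 - (i : ℤ) = z - i - 1 by ring,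
    show z - 1 - (j : ℤ) = z - j - 1 by ring]
  have h1 := mul_chooseInt (u + j) (z - i)
  have h2 := mul_chooseInt (v + i) (z - j)
  push_cast at h1 h2
  linear_combination chooseInt (v + i) (z - j - 1) * h1 - chooseInt (u + j) (z - i) * h2

/-- Multiplication of an expansion in the functions `shiftedChoose d k` by `x + c`. -/
lemma add_mul_sum_shiftedChoose (T : ℤ → ℝ) (hT : T (-1) = 0) (d x N : ℕ) (hN : x < N) (c : ℝ) :
    (x + c) * ∑ k ∈ Finset.range N, T k * shiftedChoose d k x =
      ∑ k ∈ Finset.range N, ((k + c) * T k + (d + 2 - k - c) * T ((k : ℤ) - 1)) *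
        shiftedChoose (d + 1) k x := by
  have h : ∑ k ∈ Finset.range N, ((d : ℝ) + 2 - k - c) * T ((k : ℤ) - 1) *
        shiftedChoose (d + 1) k x =
      ∑ k ∈ Finset.range N, ((d : ℝ) + 1 - k - c) * T k * shiftedChoose (d + 1) (k + 1) x := by
    have h1 := Finset.sum_range_succ (fun k : ℕ => ((d : ℝ) + 2 - k - c) * T ((k : ℤ) - 1) *
        shiftedChoose (d + 1) k x) N
    rw [Finset.sum_range_succ', shiftedChoose_of_lt _ hN] at h1
    simp only [Nat.cast_zero, zero_sub, hT, mul_zero, zero_mul, add_zero] at h1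
    rw [← h1]
    refine Finset.sum_congr rfl fun k _ => ?_
    push_cast
    rw [add_sub_cancel_right]
    ring
  simp only [add_mul (_ * T _), Finset.sum_add_distrib]
  rw [h, Finset.mul_sum, ← Finset.sum_add_distrib]
  refine Finset.sum_congr rfl fun k _ => ?_
  linear_combination T k * add_mul_shiftedChoose d k x c

lemma succ_mul_shiftedChoose_succ (d j x : ℕ) :
    ((d : ℝ) + 1) * shiftedChoose (d + 1) (j + 1) x = (x - j) * shiftedChoose d j x := by
  have h := add_mul_shiftedChoose d j x (-j)
  linear_combination -h

lemma shiftedChoose_mul (u i v j x N : ℕ) (hN : x < N) :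
    shiftedChoose (u + i) i x * shiftedChoose (v + j) j x =
      ∑ k ∈ Finset.range N, productCoeff u i v j k * shiftedChoose (u + i + (v + j)) k x := by
  induction v with
  | zero =>
    induction j with
    | zero =>
      simp only [productCoeff_zero_zero, ite_mul, one_mul, zero_mul, add_zero,
        Finset.sum_ite_eq', Finset.mem_range]
      have h0 : shiftedChoose 0 0 x = 1 := by simp [shiftedChoose]
      rw [h0, mul_one]
      split_ifs with h
      · rfl
      · exact shiftedChoose_of_lt _ (by omega)
    | succ j ih =>
      have hpos : ((0 + j : ℕ) : ℝ) + 1 ≠ 0 := by positivity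
      refine mul_left_cancel₀ hpos ?_
      have h1 := add_mul_sum_shiftedChoose (productCoeff u i 0 j)
        (productCoeff_of_neg _ _ _ _ (by norm_num)) (u + i + (0 + j)) x N hN (-j)
      have h2 := succ_mul_shiftedChoose_succ (0 + j) j x
      rw [← ih] at h1
      calc _ = ((x : ℝ) + -j) * (shiftedChoose (u + i) i x * shiftedChoose (0 + j) j x) := by
            rw [← add_assoc]
            linear_combination shiftedChoose (u + i) i x * h2
        _ = _ := by
            rw [h1, Finset.mul_sum]
            refine Finset.sum_congr rfl fun k _ => ?_
            have h3 := productCoeff_succ_right u i 0 j k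
            rw [show u + i + (0 + (j + 1)) = u + i + (0 + j) + 1 by ring]
            push_cast at h3 ⊢
            linear_combination -(shiftedChoose (u + i + (0 + j) + 1) k x) * h3
  | succ v ih =>
    have hpos : ((v + j : ℕ) : ℝ) + 1 ≠ 0 := by positivity
    refine mul_left_cancel₀ hpos ?_
    have h1 := add_mul_sum_shiftedChoose (productCoeff u i v j)
      (productCoeff_of_neg _ _ _ _ (by norm_num)) (u + i + (v + j)) x N hN (v + 1)
    have h2 := add_mul_shiftedChoose (v + j) j x (v + 1)
    rw [← ih] at h1
    calc _ = ((x : ℝ) + (v + 1)) *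
          (shiftedChoose (u + i) i x * shiftedChoose (v + j) j x) := by
          rw [add_right_comm v 1 j]
          push_cast at h2 ⊢
          linear_combination -shiftedChoose (u + i) i x * h2
      _ = _ := by
          rw [h1, Finset.mul_sum]
          refine Finset.sum_congr rfl fun k _ => ?_
          have h3 := productCoeff_succ_left u i v j k
          rw [show u + i + (v + 1 + j) = u + i + (v + j) + 1 by ring]
          push_cast at h3 ⊢
          linear_combination -(shiftedChoose (u + i + (v + j) + 1) k x) * h3

lemma mk_choose_mul_one_sub_pow (d : ℕ) :
    (PowerSeries.mk fun t : ℕ => ((t + d).choose d : ℝ)) * (1 - PowerSeries.X) ^ (d + 1) = 1 := by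
  simp_rw [add_comm _ d]
  exact PowerSeries.mk_add_choose_mul_one_sub_pow_eq_one ℝ d

lemma coeff_mul_mk_choose (f : ℝ⟦X⟧) (d x : ℕ) :
    PowerSeries.coeff x (f * PowerSeries.mk fun t : ℕ => ((t + d).choose d : ℝ)) =
      ∑ k ∈ Finset.range (x + 1), PowerSeries.coeff k f * shiftedChoose d k x := by
  rw [PowerSeries.coeff_mul, Finset.Nat.sum_antidiagonal_eq_sum_range_succ_mk]
  refine Finset.sum_congr rfl fun k hk => ?_
  rw [PowerSeries.coeff_mk, shiftedChoose, if_pos (by simpa [Nat.lt_succ_iff] using hk)]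

lemma natDegree_numeratorW_le (p : Polynomial ℝ) :
    (numeratorW p).natDegree ≤ p.natDegree :=
  Nat.lt_succ_iff.1 (PowerSeries.natDegree_trunc_lt _ _)

/-- The expansion of the values of `p` with the coefficients of its numerator polynomial. -/
lemma eval_eq_sum_numeratorW (p : Polynomial ℝ) (x : ℕ) :
    p.eval (x : ℝ) = ∑ i ∈ Finset.range (p.natDegree + 1),
      (numeratorW p).coeff i * shiftedChoose p.natDegree i x := by
  have h : genSeries p = (numeratorW p : ℝ⟦X⟧) *
      PowerSeries.mk fun t : ℕ => ((t + p.natDegree).choose p.natDegree : ℝ) := by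
    rw [coe_numeratorW, mul_assoc, mul_comm (_ ^ _), mk_choose_mul_one_sub_pow, mul_one]
  have h1 := congrArg (PowerSeries.coeff x) h
  rw [coeff_mul_mk_choose, genSeries, PowerSeries.coeff_mk] at h1
  simp only [Polynomial.coeff_coe] at h1
  rw [h1]
  have key (N M : ℕ) (h : ∀ k, M ≤ k → (numeratorW p).coeff k * shiftedChoose p.natDegree k x = 0)
      (hNM : M ≤ N) : ∑ k ∈ Finset.range N, (numeratorW p).coeff k * shiftedChoose p.natDegree k x
        = ∑ k ∈ Finset.range M, (numeratorW p).coeff k * shiftedChoose p.natDegree k x :=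
    (Finset.sum_subset (Finset.range_mono hNM) fun k _ hk => h k (by simpa using hk)).symm
  rw [← key (max (x + 1) (p.natDegree + 1)) (x + 1) _ (le_max_left _ _),
    key _ (p.natDegree + 1) _ (le_max_right _ _)]
  · intro k hk
    rw [Polynomial.coeff_eq_zero_of_natDegree_lt
      ((natDegree_numeratorW_le p).trans_lt (Nat.lt_of_succ_le hk)), zero_mul]
  · intro k hk
    rw [shiftedChoose_of_lt _ (Nat.lt_of_succ_le hk), mul_zero]

/-- An expansion of the values of `p` determines its numerator polynomial. -/
lemma coeff_numeratorW_of_eval (p : Polynomial ℝ) (c : ℕ → ℝ)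
    (h : ∀ x : ℕ, p.eval (x : ℝ) =
      ∑ k ∈ Finset.range (x + 1), c k * shiftedChoose p.natDegree k x) (k : ℕ) :
    (numeratorW p).coeff k = c k := by
  have h1 : genSeries p = PowerSeries.mk c *
      PowerSeries.mk fun t : ℕ => ((t + p.natDegree).choose p.natDegree : ℝ) := by
    ext x
    rw [coeff_mul_mk_choose, genSeries, PowerSeries.coeff_mk, h]
    simp only [PowerSeries.coeff_mk]
  rw [← Polynomial.coeff_coe, coe_numeratorW, h1, mul_assoc, mk_choose_mul_one_sub_pow, mul_one,
    PowerSeries.coeff_mk]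

lemma coeff_numeratorW_mul {p q : Polynomial ℝ} (hp : p ≠ 0) (hq : q ≠ 0) (k : ℕ) :
    (numeratorW (p * q)).coeff k =
      ∑ i ∈ Finset.range (p.natDegree + 1), ∑ j ∈ Finset.range (q.natDegree + 1),
        (numeratorW p).coeff i * (numeratorW q).coeff j *
          productCoeff (p.natDegree - i) i (q.natDegree - j) j k := by
  refine coeff_numeratorW_of_eval (p * q) (fun k => ∑ i ∈ Finset.range (p.natDegree + 1),
    ∑ j ∈ Finset.range (q.natDegree + 1), (numeratorW p).coeff i * (numeratorW q).coeff j *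
      productCoeff (p.natDegree - i) i (q.natDegree - j) j k) (fun x => ?_) k
  rw [Polynomial.eval_mul, eval_eq_sum_numeratorW p, eval_eq_sum_numeratorW q,
    Finset.sum_mul_sum, Polynomial.natDegree_mul hp hq]
  simp only [Finset.sum_mul]
  conv_rhs => rw [Finset.sum_comm]
  refine Finset.sum_congr rfl fun i hi => ?_
  conv_rhs => rw [Finset.sum_comm]
  refine Finset.sum_congr rfl fun j hj => ?_
  have h := shiftedChoose_mul (p.natDegree - i) i (q.natDegree - j) j x (x + 1) x.lt_succ_self
  rw [Nat.sub_add_cancel (Nat.lt_succ_iff.1 (Finset.mem_range.1 hi)),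
    Nat.sub_add_cancel (Nat.lt_succ_iff.1 (Finset.mem_range.1 hj))] at h
  rw [mul_mul_mul_comm, h, Finset.mul_sum]
  exact Finset.sum_congr rfl fun k _ => by ring

/-- The support of the numerator polynomial of a product is a union of intervals. -/
lemma coeff_numeratorW_mul_ne_zero_iff {p q : Polynomial ℝ}
    (hp : ∀ i, 0 ≤ (numeratorW p).coeff i) (hq : ∀ i, 0 ≤ (numeratorW q).coeff i)
    (hp0 : p ≠ 0) (hq0 : q ≠ 0) (k : ℕ) :
    (numeratorW (p * q)).coeff k ≠ 0 ↔
      ∃ i j, (numeratorW p).coeff i ≠ 0 ∧ (numeratorW q).coeff j ≠ 0 ∧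
        i ≤ k ∧ j ≤ k ∧ k ≤ p.natDegree + j ∧ k ≤ q.natDegree + i := by
  have hterm (i j : ℕ) : 0 ≤ (numeratorW p).coeff i * (numeratorW q).coeff j *
      productCoeff (p.natDegree - i) i (q.natDegree - j) j k :=
    mul_nonneg (mul_nonneg (hp i) (hq j)) (productCoeff_nonneg _ _ _ _ _)
  rw [coeff_numeratorW_mul hp0 hq0]
  constructor
  · intro h
    obtain ⟨i, hi, h⟩ := Finset.exists_ne_zero_of_sum_ne_zero h
    obtain ⟨j, hj, h⟩ := Finset.exists_ne_zero_of_sum_ne_zero h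
    rw [mul_ne_zero_iff, mul_ne_zero_iff, productCoeff_ne_zero_iff] at h
    simp only [Finset.mem_range] at hi hj
    exact ⟨i, j, h.1.1, h.1.2, by omega⟩
  · rintro ⟨i, j, hi, hj, h⟩
    have hi' := (Polynomial.le_natDegree_of_ne_zero hi).trans (natDegree_numeratorW_le p)
    have hj' := (Polynomial.le_natDegree_of_ne_zero hj).trans (natDegree_numeratorW_le q)
    refine (Finset.sum_pos' (fun i _ => Finset.sum_nonneg fun j _ => hterm i j)
      ⟨i, by simpa [Nat.lt_succ_iff] using hi', Finset.sum_pos' (fun j _ => hterm i j)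
        ⟨j, by simpa [Nat.lt_succ_iff] using hj', (hterm i j).lt_of_ne' ?_⟩⟩).ne'
    rw [mul_ne_zero_iff, mul_ne_zero_iff, productCoeff_ne_zero_iff]
    exact ⟨⟨hi, hj⟩, by omega⟩

lemma NoInternalZeros.coeff_ne_zero {a : Polynomial ℝ} (ha : NoInternalZeros a) {i j k : ℕ}
    (hij : i < j) (hjk : j < k) (hi : a.coeff i ≠ 0) (hk : a.coeff k ≠ 0) : a.coeff j ≠ 0 :=
  fun h => ha ⟨i, j, k, hij, hjk, h, mul_ne_zero hi hk⟩

lemma NoInternalZeros.exists_coeff_ne_zero {a : Polynomial ℝ} (ha : NoInternalZeros a)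
    {i i' k n : ℕ} (hi : a.coeff i ≠ 0) (hi' : a.coeff i' ≠ 0) (hik : i ≤ k) (hki : k < n + i') :
    ∃ l, a.coeff l ≠ 0 ∧ l ≤ k ∧ k ≤ n + l := by
  rcases le_or_gt k (n + i) with h | h
  · exact ⟨i, hi, hik, h⟩
  · exact ⟨k - n, ha.coeff_ne_zero (by omega) (by omega) hi hi', by omega, by omega⟩

theorem mainTheorem9 (p q : Polynomial ℝ)
    (hp : ∀ i, 0 ≤ (numeratorW p).coeff i) (hp' : NoInternalZeros (numeratorW p))
    (hq : ∀ i, 0 ≤ (numeratorW q).coeff i) (hq' : NoInternalZeros (numeratorW q)) :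
    NoInternalZeros (numeratorW (p * q)) := by
  rcases eq_or_ne p 0 with rfl | hp0
  · rwa [zero_mul]
  rcases eq_or_ne q 0 with rfl | hq0
  · rwa [mul_zero]
  rintro ⟨r, s, t, hrs, hst, hs, hrt⟩
  have hsupp := coeff_numeratorW_mul_ne_zero_iff hp hq hp0 hq0
  obtain ⟨i, j, hi, hj, hir, hjr, -⟩ := (hsupp r).1 (left_ne_zero_of_mul hrt)
  obtain ⟨i', j', hi', hj', -, -, htj, hti⟩ := (hsupp t).1 (right_ne_zero_of_mul hrt)
  obtain ⟨l, hl, hls, hsl⟩ := hp'.exists_coeff_ne_zero (k := s) (n := q.natDegree) hi hi'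
    (by omega) (by omega)
  obtain ⟨l', hl', hls', hsl'⟩ := hq'.exists_coeff_ne_zero (k := s) (n := p.natDegree) hj hj'
    (by omega) (by omega)
  exact (hsupp s).2 ⟨l, l', hl, hl', hls, hls', hsl', hsl⟩ hs
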